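/- Let $K$ be an algebraically closed field of characteristic zero and let $n\ge 3$. Write $x^{(k)}=x^k/k!$. For integers $m\ge k\ge 2$ let the caustic $\Sigma_{m,k}\subseteq\mathbb A^m_K$ be the variety of all $(s_1,\dots,s_m)$ such that the polynomial $x^{(m)}+s_1x^{(m-1)}+\cdots+s_m$ has a root of multiplicity at least $k$, and let $\mathcal O_{\Sigma_{m,k}}=K[s_1,\dots,s_m]/I(\Sigma_{m,k})$ be its coordinate ring. Differentiation with respect to $x$ maps $\Sigma_{m+1,k+1}$ to $\Sigma_{m,k}$ by $(s_1,\dots,s_{m+1})\mapsto(s_1,\dots,s_m)$. This gives the tower of caustics $$\cdots\to\Sigma_{n+i+1,i+3}\to\Sigma_{n+i,i+2}\to\cdots\to\Sigma_{n+1,3}\to\Sigma_{n,2}=\Delta$$ over the affine discriminant $\Delta=\Delta_n$. Let $\Sigma=\Sigma_{2n-3,n-1}$ be the term $i=n-3$ of this tower (the geometric open swallowtail of Arnol'd and Givental). Let $\bar\Delta$ be the incidence variety of pairs $(f,t)$ with $t$ a repeated root of $f$. It is the closed subscheme of $\mathbb A^{n+1}_K$ defined by $F=\partial F/\partial x=0$,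 where $F=x^{(n)}+s_1x^{(n-1)}+\cdots+s_n$, so that $\mathcal O_{\bar\Delta}=K[s_1,\dots,s_n,x]/(F,\partial F/\partial x)$. It is an $\mathcal O_\Delta$-algebra through the normalization map $\bar\Delta\to\Delta$, $(f,t)\mapsto f$. The algebraic open swallowtail is the $\mathcal O_\Delta$-subalgebra $$\mathcal S=\ker\bigl(d:\mathcal O_{\bar\Delta}\to\Omega^1_{\bar\Delta/\Delta}\bigr)\subseteq\mathcal O_{\bar\Delta},$$ where $d$ is the universal derivation. Theorem. (1) $\Sigma$ is the stable term of the tower of caustics: for every integer $i\ge 0$, the homomorphism of coordinate rings $\mathcal O_{\Sigma_{n+i,i+2}}\to\mathcal O_{\Sigma_{n+i+1,i+3}}$ induced by differentiation is an isomorphism if and only if $i\ge n-3$. (2) There is exactly one homomorphism of $\mathcal O_\Delta$-algebras $\mathcal O_\Sigma\to\mathcal O_{\bar\Delta}$. It is injective, and its image equals $\mathcal S$. -/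

import Mathlib

open Polynomial

noncomputable section

namespace OpenSwallowtail

/-- The divided power `x^{(k)} = x^k / k!`, as a polynomial over a `K`-algebra `A`. -/
def dividedPow (K : Type*) [Field K] (A : Type*) [CommRing A] [Algebra K A] (k : ℕ) : A[X] :=
  monomial k (algebraMap K A ((Nat.factorial k : K)⁻¹))

/-- The polynomial `x^{(m)} + s₁ x^{(m-1)} + ⋯ + s_m`. The coefficient `s_{i+1}` of the text is
`s i` here, `0 ≤ i < m`. -/
def dpPoly (K : Type*) [Field K] {A : Type*} [CommRing A] [Algebra K A] (m : ℕ)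
    (s : Fin m → A) : A[X] :=
  dividedPow K A m + ∑ i : Fin m, C (s i) * dividedPow K A (m - (i + 1))

/-- The caustic `Σ_{m,k}`: the points `s` of affine `m`-space for which the polynomial
`x^{(m)} + s₁ x^{(m-1)} + ⋯ + s_m` has a root of multiplicity at least `k`. In particular
`Σ_{n,2}` is the affine discriminant `Δ_n`. -/
def caustic (K : Type*) [Field K] (m k : ℕ) : Set (Fin m → K) :=
  {s | ∃ t : K, (X - C t) ^ k ∣ dpPoly K m s}

/-- The coordinate ring of `Σ_{m,k}`: polynomials in `s₁, …, s_m` modulo those vanishing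
on `Σ_{m,k}`. -/
def CausticRing (K : Type*) [Field K] (m k : ℕ) : Type _ :=
  MvPolynomial (Fin m) K ⧸ MvPolynomial.vanishingIdeal K (caustic K m k)

instance (K : Type*) [Field K] (m k : ℕ) : CommRing (CausticRing K m k) :=
  inferInstanceAs (CommRing (_ ⧸ MvPolynomial.vanishingIdeal K (caustic K m k)))

instance (K : Type*) [Field K] (m k : ℕ) : Algebra K (CausticRing K m k) :=
  inferInstanceAs (Algebra K (_ ⧸ MvPolynomial.vanishingIdeal K (caustic K m k)))

/-- The universal polynomial of degree `n`, over the ring `K[s₁, …, s_n]`. -/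
def univPoly (K : Type*) [Field K] (n : ℕ) : (MvPolynomial (Fin n) K)[X] :=
  dpPoly K n (fun i => MvPolynomial.X i)

/-- The ideal `(F, ∂F/∂x)` of `K[s₁, …, s_n][x]`, with `F` the universal polynomial. -/
def incidenceIdeal (K : Type*) [Field K] (n : ℕ) : Ideal (MvPolynomial (Fin n) K)[X] :=
  Ideal.span {univPoly K n, derivative (univPoly K n)}

/-- The coordinate ring of the incidence variety `Δ̄_n` of pairs (polynomial, repeated root),
that is, of the closed subvariety of affine `(n+1)`-space given by `F = ∂F/∂x = 0`. -/
def IncidenceRing (K : Type*) [Field K] (n : ℕ) : Type _ :=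
  (MvPolynomial (Fin n) K)[X] ⧸ incidenceIdeal K n

instance (K : Type*) [Field K] (n : ℕ) : CommRing (IncidenceRing K n) :=
  inferInstanceAs (CommRing (_ ⧸ incidenceIdeal K n))

instance (K : Type*) [Field K] (n : ℕ) : Algebra K (IncidenceRing K n) :=
  inferInstanceAs (Algebra K (_ ⧸ incidenceIdeal K n))

section Helpers

variable {K : Type*} [Field K]

theorem derivative_dividedPow_succ [CharZero K] {A : Type*} [CommRing A] [Algebra K A] (k : ℕ) :
    derivative (dividedPow K A (k + 1)) = dividedPow K A k := by
  have h : ((Nat.factorial (k + 1) : K)⁻¹) * ((k + 1 : ℕ) : K) = (Nat.factorial k : K)⁻¹ := by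
    have h1 : ((k + 1 : ℕ) : K) ≠ 0 := by exact_mod_cast Nat.succ_ne_zero k
    have h2 : (Nat.factorial k : K) ≠ 0 := by exact_mod_cast Nat.factorial_ne_zero k
    rw [Nat.factorial_succ]
    push_cast at h1 ⊢
    field_simp
  rw [dividedPow, dividedPow, derivative_monomial, ← h, RingHom.map_mul, map_natCast]
  simp

theorem derivative_dividedPow_zero {A : Type*} [CommRing A] [Algebra K A] :
    derivative (dividedPow K A 0) = 0 := by
  simp [dividedPow]

/-- Differentiation with respect to `x` forgets the last coefficient. -/
theorem derivative_dpPoly [CharZero K] {A : Type*} [CommRing A] [Algebra K A] (m : ℕ)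
    (s : Fin (m + 1) → A) :
    derivative (dpPoly K (m + 1) s) = dpPoly K m (fun i => s i.castSucc) := by
  rw [dpPoly, dpPoly, Fin.sum_univ_castSucc, derivative_add, derivative_add,
    derivative_dividedPow_succ, derivative_sum]
  have hl : derivative (C (s (Fin.last m)) *
      dividedPow K A (m + 1 - (((Fin.last m : Fin (m + 1)) : ℕ) + 1))) = 0 := by
    simp [derivative_dividedPow_zero]
  rw [hl, add_zero]
  congr 1
  refine Finset.sum_congr rfl fun i _ => ?_
  have hi : m + 1 - (((i.castSucc : Fin (m + 1)) : ℕ) + 1) = (m - ((i : ℕ) + 1)) + 1 := by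
    have := i.isLt
    simp only [Fin.val_castSucc]
    omega
  rw [hi, derivative_C_mul, derivative_dividedPow_succ]

/-- The `d`-fold derivative forgets the last `d` coefficients. -/
theorem iterate_derivative_dpPoly [CharZero K] {A : Type*} [CommRing A] [Algebra K A] (m d : ℕ)
    (s : Fin (m + d) → A) :
    derivative^[d] (dpPoly K (m + d) s) = dpPoly K m (fun i => s (Fin.castAdd d i)) := by
  induction d with
  | zero => rfl
  | succ d ih =>
    rw [Function.iterate_succ_apply]
    exact (congrArg _ (derivative_dpPoly (m + d) s)).trans (ih _)

/-- `d`-fold differentiation maps `Σ_{m+d,k+d}` to `Σ_{m,k}`. -/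
theorem mem_caustic_of_mem [CharZero K] (m k d : ℕ) {s : Fin (m + d) → K}
    (hs : s ∈ caustic K (m + d) (k + d)) : (fun i => s (Fin.castAdd d i)) ∈ caustic K m k := by
  obtain ⟨t, ht⟩ := hs
  refine ⟨t, ?_⟩
  rw [← iterate_derivative_dpPoly]
  have := Polynomial.pow_sub_dvd_iterate_derivative_of_pow_dvd (m := d) ht
  simpa using this

theorem map_vanishingIdeal_le [CharZero K] (m k d : ℕ) (p : MvPolynomial (Fin m) K)
    (hp : p ∈ MvPolynomial.vanishingIdeal K (caustic K m k)) :
    MvPolynomial.rename (Fin.castAdd d) p ∈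
      MvPolynomial.vanishingIdeal K (caustic K (m + d) (k + d)) := by
  rw [MvPolynomial.mem_vanishingIdeal_iff] at hp ⊢
  intro s hs
  rw [MvPolynomial.aeval_rename]
  exact hp _ (mem_caustic_of_mem m k d hs)

theorem sq_dvd_sub_tangent (P : K[X]) (t : K) :
    (X - C t) ^ 2 ∣ P - C (P.derivative.eval t) * X
      - C (P.eval t - t * P.derivative.eval t) := by
  set Q := P - C (P.derivative.eval t) * X - C (P.eval t - t * P.derivative.eval t) with hQ
  have h0 : Q.IsRoot t := by simp [hQ, IsRoot.def]; ring
  have h1 : Q.derivative.eval t = 0 := by simp [hQ]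
  obtain ⟨R, hR⟩ := dvd_iff_isRoot.mpr h0
  have h2 : R.IsRoot t := by
    rw [hR] at h1
    simpa [derivative_mul] using h1
  obtain ⟨T, hT⟩ := dvd_iff_isRoot.mpr h2
  exact ⟨T, by rw [hR, hT]; ring⟩

/-- The coefficients of `F(Y) - F(x) - F'(x)(Y - x)` as a polynomial in `Y`. -/
def tangentCoeff (K : Type*) [Field K] (n : ℕ) (i : Fin n) : (MvPolynomial (Fin n) K)[X] :=
  C (MvPolynomial.X i) - (if (i : ℕ) + 2 = n then derivative (univPoly K n) else 0)
    - (if (i : ℕ) + 1 = n then univPoly K n - X * derivative (univPoly K n) else 0)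

theorem map_univPoly (n : ℕ) (s : Fin n → K) :
    (univPoly K n).map (MvPolynomial.eval s) = dpPoly K n s := by
  have h (k : ℕ) : (dividedPow K (MvPolynomial (Fin n) K) k).map (MvPolynomial.eval s)
      = dividedPow K K k := by
    simp [dividedPow, map_monomial, MvPolynomial.algebraMap_eq]
  simp [univPoly, dpPoly, Polynomial.map_sum, h]

theorem tangent_mem_caustic (n : ℕ) (s : Fin (n + 2) → K) (t : K) :
    (fun i => ((tangentCoeff K (n + 2) i).map (MvPolynomial.eval s)).eval t)
      ∈ caustic K (n + 2) 2 := by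
  refine ⟨t, ?_⟩
  set P := dpPoly K (n + 2) s with hP
  have key : dpPoly K (n + 2)
      (fun i => ((tangentCoeff K (n + 2) i).map (MvPolynomial.eval s)).eval t)
      = P - C (P.derivative.eval t) * X - C (P.eval t - t * P.derivative.eval t) := by
    have hc (i : Fin (n + 2)) : ((tangentCoeff K (n + 2) i).map (MvPolynomial.eval s)).eval t
        = s i - (if (i : ℕ) + 2 = n + 2 then P.derivative.eval t else 0)
          - (if (i : ℕ) + 1 = n + 2 then P.eval t - t * P.derivative.eval t else 0) := by
      rw [hP, ← map_univPoly, tangentCoeff]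
      split_ifs <;> simp [Polynomial.derivative_map]
    simp only [hc]
    rw [hP, dpPoly, dpPoly, Fin.sum_univ_castSucc, Fin.sum_univ_castSucc,
      Fin.sum_univ_castSucc (n := n + 1), Fin.sum_univ_castSucc (n := n)]
    have hlt (i : Fin n) : (i : ℕ) ≠ n := i.isLt.ne
    have hlt' (i : Fin n) : (i : ℕ) ≠ n + 1 := by have := i.isLt; omega
    simp [hlt, hlt', dividedPow, ← C_mul_X_pow_eq_monomial]
    ring
  rw [key]
  exact sq_dvd_sub_tangent P t

theorem C_mem_incidenceIdeal [CharZero K] (n : ℕ) (p : MvPolynomial (Fin n) K)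
    (hp : p ∈ MvPolynomial.vanishingIdeal K (caustic K n 2)) :
    (C p : (MvPolynomial (Fin n) K)[X]) ∈ incidenceIdeal K n := by
  have hF : univPoly K n ∈ incidenceIdeal K n := Ideal.subset_span (by simp)
  have hF' : derivative (univPoly K n) ∈ incidenceIdeal K n := Ideal.subset_span (by simp)
  match n, p, hp, hF, hF' with
  | 0, p, hp, hF, hF' =>
    have : univPoly K 0 = 1 := by simp [univPoly, dpPoly, dividedPow]
    rw [this] at hF
    rw [(Ideal.eq_top_iff_one _).mpr hF]
    trivial
  | 1, p, hp, hF, hF' =>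
    have : derivative (univPoly K 1) = 1 := by
      rw [univPoly, derivative_dpPoly]
      simp [dpPoly, dividedPow]
    rw [this] at hF'
    rw [(Ideal.eq_top_iff_one _).mpr hF']
    trivial
  | n + 2, p, hp, hF, hF' =>
    rw [MvPolynomial.mem_vanishingIdeal_iff] at hp
    set θ : MvPolynomial (Fin (n + 2)) K →ₐ[K] (MvPolynomial (Fin (n + 2)) K)[X] :=
      MvPolynomial.aeval (tangentCoeff K (n + 2)) with hθ
    have hzero : θ p = 0 := by
      ext1 j
      refine MvPolynomial.funext fun s => ?_
      have hs : (θ p).map (MvPolynomial.eval s) = 0 := by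
        refine Polynomial.funext fun t => ?_
        have h := hp _ (tangent_mem_caustic n s t)
        rw [eval_zero, ← h]
        have e : ((Polynomial.evalRingHom t).comp
            (Polynomial.mapRingHom (MvPolynomial.eval s))).comp (θ : _ →+* _)
            = RingHomClass.toRingHom (MvPolynomial.aeval (R := K) fun i =>
              ((tangentCoeff K (n + 2) i).map (MvPolynomial.eval s)).eval t) := by
          refine MvPolynomial.ringHom_ext (fun a => ?_) (fun i => ?_)
          · simp [hθ, Polynomial.algebraMap_apply, MvPolynomial.algebraMap_eq]
          · simp [hθ]
        exact congrArg (fun g : _ →+* K => g p) e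
      have := congrArg (fun q => q.coeff j) hs
      simpa using this
    have hcomp : (Ideal.Quotient.mkₐ K (incidenceIdeal K (n + 2))).comp θ
        = (Ideal.Quotient.mkₐ K (incidenceIdeal K (n + 2))).comp
          (Algebra.ofId (MvPolynomial (Fin (n + 2)) K)
            (MvPolynomial (Fin (n + 2)) K)[X] |>.restrictScalars K) := by
      refine MvPolynomial.algHom_ext fun i => ?_
      simp only [AlgHom.comp_apply, hθ, MvPolynomial.aeval_X, Ideal.Quotient.mkₐ_eq_mk]
      rw [Ideal.Quotient.eq]
      change tangentCoeff K (n + 2) i - C (MvPolynomial.X i) ∈ _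
      rw [tangentCoeff, sub_sub (C (MvPolynomial.X i : MvPolynomial (Fin (n + 2)) K)),
        sub_sub_cancel_left]
      refine neg_mem (add_mem ?_ ?_)
      · split_ifs
        · exact hF'
        · exact zero_mem _
      · split_ifs
        · exact sub_mem hF (Ideal.mul_mem_left _ _ hF')
        · exact zero_mem _
    have h := congrArg (fun g => g p) hcomp
    simp only [AlgHom.comp_apply, hzero, map_zero] at h
    exact Ideal.Quotient.eq_zero_iff_mem.mp h.symm

end Helpers

/-- The homomorphism of coordinate rings `𝒪(Σ_{m,k}) → 𝒪(Σ_{m+d,k+d})` induced by `d`-fold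
differentiation `Σ_{m+d,k+d} → Σ_{m,k}`, which is the projection
`(s₁, …, s_{m+d}) ↦ (s₁, …, s_m)`. -/
def diffPullback (K : Type*) [Field K] [CharZero K] (m k d : ℕ) :
    CausticRing K m k →ₐ[K] CausticRing K (m + d) (k + d) :=
  Ideal.quotientMapₐ (MvPolynomial.vanishingIdeal K (caustic K (m + d) (k + d)))
    (MvPolynomial.rename (Fin.castAdd d)) (map_vanishingIdeal_le m k d)

/-- The homomorphism of coordinate rings `𝒪(Δ_n) → 𝒪(Δ̄_n)` induced by the normalization map
`Δ̄_n → Δ_n`, `(f, t) ↦ f`. -/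
def normalizationPullback (K : Type*) [Field K] [CharZero K] (n : ℕ) :
    CausticRing K n 2 →ₐ[K] IncidenceRing K n :=
  Ideal.quotientMapₐ (incidenceIdeal K n)
    ((Algebra.ofId (MvPolynomial (Fin n) K) (MvPolynomial (Fin n) K)[X]).restrictScalars K)
    (C_mem_incidenceIdeal n)

instance incidenceAlgebra (K : Type*) [Field K] [CharZero K] (n : ℕ) :
    Algebra (CausticRing K n 2) (IncidenceRing K n) :=
  RingHom.toAlgebra (normalizationPullback K n).toRingHom

/-- The algebraic open swallowtail `𝒮_n` (over the affine piece of monic polynomials): the kernel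
of the universal derivation `d : 𝒪(Δ̄_n) → Ω¹_{Δ̄_n/Δ_n}`, an `𝒪(Δ_n)`-subalgebra of `𝒪(Δ̄_n)`. -/
def algebraicOpenSwallowtail (K : Type*) [Field K] [CharZero K] (n : ℕ) :
    Subalgebra (CausticRing K n 2) (IncidenceRing K n) where
  carrier := {g | KaehlerDifferential.D (CausticRing K n 2) (IncidenceRing K n) g = 0}
  mul_mem' {a b} ha hb := by
    simp only [Set.mem_ofPred_eq] at ha hb ⊢
    rw [Derivation.leibniz, ha, hb, smul_zero, smul_zero, add_zero]
  add_mem' {a b} ha hb := by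
    simp only [Set.mem_ofPred_eq] at ha hb ⊢
    rw [map_add, ha, hb, add_zero]
  algebraMap_mem' r := by
    simp only [Set.mem_ofPred_eq]
    exact Derivation.map_algebraMap _ r

end OpenSwallowtail

end

open OpenSwallowtail

open Polynomial

noncomputable section

namespace OpenSwallowtail

/-! Write `n = N + 2`. All caustics in the tower satisfy `m - k = N` and are parametrized by a root
`x` and the free coefficients `s_1, …, s_N`: vanishing of the first `k` derivatives at the root
(orders `0` to `k - 1`) determines the later coefficients recursively as polynomials `coeffSeq j` in
`B = K[s_1, …, s_N][x]`. Hence every coordinate ring in the tower is the subring `coeffSubalgebra m`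
of `B` generated by the coefficients up to index `m`, the transition maps are inclusions, and `B` is
the coordinate ring of the incidence variety.

Let `w = criticalPoly` be the second derivative `∂²F/∂x²` on the incidence variety; it has degree
`N` in `x`. The key formula `derivative_coeffSeq` says that the derivative of `coeffSeq (N+1+M)` is
`-w (-x)^{(M)}`. So all these subrings lie in `swallowtail`, the ring of `g` with `w ∣ g'`, and the
new generators have degree equal to their index, with invertible leading coefficient. A degree
reduction gives equality from `m = 2N+1` on (`coeffSubalgebra_eq_swallowtail`); specializing the
free coefficients to zero shows that each earlier step is strict
(`coeffSeq_notMem_coeffSubalgebra`).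

Over the discriminant, the differentials of `B` are generated by `dx`, with `w dx = 0`, so `dg = 0`
exactly when `w ∣ g'` (`D_eq_zero_iff`). Uniqueness holds because every element of `B` has a nonzero
multiple in the ring of the discriminant (`exists_mul_mem`). -/

/-- The divided power `r^{(k)} = r^k / k!` of an element of a `K`-algebra. -/
def dpow (K : Type*) [Field K] {A : Type*} [CommRing A] [Algebra K A] (r : A) (k : ℕ) : A :=
  algebraMap K A ((Nat.factorial k : K)⁻¹) * r ^ k

/-- The sequence `1, s₁, …, s_m, 0, 0, …`. -/
def extendSeq {A : Type*} [CommRing A] {m : ℕ} (s : Fin m → A) : ℕ → A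
  | 0 => 1
  | i + 1 => if h : i < m then s ⟨i, h⟩ else 0

/-- The sum `∑ v_b r^{(j-b)}` over `b ≤ j`. -/
def dpSum (K : Type*) [Field K] {A : Type*} [CommRing A] [Algebra K A] (v : ℕ → A) (r : A)
    (j : ℕ) : A :=
  ∑ b ∈ Finset.range (j + 1), v b * dpow K r (j - b)

/-! ### Divided-power sums and root multiplicity. -/

section General

variable {K : Type*} [Field K] {A : Type*} [CommRing A] [Algebra K A]

theorem extendSeq_zero {m : ℕ} (s : Fin m → A) : extendSeq s 0 = 1 := rfl

theorem extendSeq_succ {m : ℕ} (s : Fin m → A) (i : Fin m) : extendSeq s (i + 1) = s i := by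
  simp [extendSeq]

theorem dpow_zero (r : A) : dpow K r 0 = 1 := by simp [dpow]

theorem map_dpow {B : Type*} [CommRing B] [Algebra K B] (f : A →ₐ[K] B) (r : A) (k : ℕ) :
    f (dpow K r k) = dpow K (f r) k := by simp [dpow]

theorem map_dpSum {B : Type*} [CommRing B] [Algebra K B] (f : A →ₐ[K] B) (v : ℕ → A) (r : A)
    (j : ℕ) : f (dpSum K v r j) = dpSum K (fun b => f (v b)) (f r) j := by
  simp [dpSum, map_dpow]

theorem dpow_X (k : ℕ) : dpow K (X : A[X]) k = dividedPow K A k := by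
  rw [dpow, dividedPow, ← C_mul_X_pow_eq_monomial, Polynomial.algebraMap_apply]

theorem dpSum_eq (v : ℕ → A) (r : A) (j : ℕ) :
    dpSum K v r j = (∑ b ∈ Finset.range j, v b * dpow K r (j - b)) + v j := by
  rw [dpSum, Finset.sum_range_succ, Nat.sub_self, dpow_zero, mul_one]

theorem dpSum_congr {v v' : ℕ → A} (r : A) (j : ℕ) (h : ∀ b ≤ j, v b = v' b) :
    dpSum K v r j = dpSum K v' r j :=
  Finset.sum_congr rfl fun b hb => by rw [h b (by simpa [Nat.lt_succ_iff] using hb)]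

theorem dpPoly_eq_dpSum {m : ℕ} (s : Fin m → A) :
    dpPoly K m s = dpSum K (fun b => C (extendSeq s b)) X m := by
  rw [dpPoly, dpSum, Finset.sum_range_succ', ← Fin.sum_univ_eq_sum_range
    (fun b => C (extendSeq s (b + 1)) * dpow K (X : A[X]) (m - (b + 1))), add_comm]
  simp [extendSeq_succ, extendSeq_zero, dpow_X]

theorem derivative_dpSum [CharZero K] (v : ℕ → A[X]) (j : ℕ) :
    derivative (dpSum K v X (j + 1)) =
      dpSum K (fun b => derivative (v b)) X (j + 1) + dpSum K v X j := by
  have h : ∀ b ∈ Finset.range (j + 1), derivative (v b * dpow K X (j + 1 - b)) =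
      derivative (v b) * dpow K X (j + 1 - b) + v b * dpow K X (j - b) := by
    intro b hb
    have hb' : j + 1 - b = j - b + 1 := by
      have := Finset.mem_range.mp hb
      omega
    rw [derivative_mul, hb', dpow_X, derivative_dividedPow_succ, dpow_X]
  rw [dpSum_eq, derivative_add, derivative_sum, Finset.sum_congr rfl h, Finset.sum_add_distrib,
    dpSum_eq, dpSum]
  ring

theorem derivative_dpSum_C [CharZero K] (v : ℕ → A) (j : ℕ) :
    derivative (dpSum K (fun b => C (v b)) X (j + 1)) = dpSum K (fun b => C (v b)) X j := by
  rw [derivative_dpSum]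
  simp [dpSum]

theorem iterate_derivative_dpSum_C [CharZero K] (v : ℕ → A) (d j : ℕ) :
    derivative^[d] (dpSum K (fun b => C (v b)) X (j + d)) = dpSum K (fun b => C (v b)) X j := by
  induction d with
  | zero => rfl
  | succ d ih => rw [Function.iterate_succ_apply, ← Nat.add_assoc, derivative_dpSum_C, ih]

theorem eval_dpSum_C (v : ℕ → A) (t : A) (j : ℕ) :
    (dpSum K (fun b => C (v b)) X j).eval t = dpSum K v t j := by
  simp [dpSum, dpow, eval_finsetSum, Polynomial.algebraMap_apply]

/-- The binomial formula `(y + x)^{(M)} = ∑ y^{(k)} x^{(M-k)}`. -/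
theorem dpow_add [CharZero K] (x y : A) (M : ℕ) :
    dpow K (y + x) M = dpSum K (dpow K y) x M := by
  rw [dpow, add_pow, dpSum, Finset.mul_sum]
  refine Finset.sum_congr rfl fun k hk => ?_
  have hk' : k ≤ M := by simpa [Nat.lt_succ_iff] using hk
  have h : (Nat.factorial M : K)⁻¹ * (M.choose k : K) =
      (Nat.factorial k : K)⁻¹ * (Nat.factorial (M - k) : K)⁻¹ := by
    have h0 := Nat.choose_mul_factorial_mul_factorial hk'
    have h1 : (Nat.factorial M : K) ≠ 0 := by exact_mod_cast Nat.factorial_ne_zero M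
    have h2 : (Nat.factorial k : K) ≠ 0 := by exact_mod_cast Nat.factorial_ne_zero k
    have h3 : (Nat.factorial (M - k) : K) ≠ 0 := by exact_mod_cast Nat.factorial_ne_zero _
    field_simp
    rw [← h0]
    push_cast
    ring
  have h' := congrArg (algebraMap K A) h
  simp only [map_mul, map_natCast] at h'
  rw [dpow, dpow]
  linear_combination (y ^ k * x ^ (M - k)) * h'

/-- This is `exp(-x) exp(x) = 1` degree by degree; it inverts the triangular system met in
`derivative_coeffSeq`. -/
theorem dpSum_dpow_neg [CharZero K] (x : A) (M : ℕ) :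
    dpSum K (dpow K (-x)) x M = if M = 0 then 1 else 0 := by
  rw [← dpow_add, neg_add_cancel, dpow]
  split_ifs with h <;> simp [h]

theorem dpSum_mul_left (c : A) (v : ℕ → A) (x : A) (j : ℕ) :
    dpSum K (fun b => c * v b) x j = c * dpSum K v x j := by
  simp [dpSum, Finset.mul_sum, mul_assoc]

/-- A sequence is determined by the sums `dpSum`. -/
theorem eq_of_dpSum_eq {v v' : ℕ → A} {r : A} (m : ℕ)
    (h : ∀ j ≤ m, v j = v' j ∨ dpSum K v r j = dpSum K v' r j) : ∀ j ≤ m, v j = v' j := by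
  intro j
  induction j using Nat.strong_induction_on with
  | _ j ih =>
    intro hj
    rcases h j hj with h | h
    · exact h
    · rw [dpSum_eq, dpSum_eq, Finset.sum_congr rfl fun b hb => by
        rw [ih b (Finset.mem_range.mp hb) ((Finset.mem_range.mp hb).le.trans hj)]] at h
      exact add_left_cancel h

/-- In characteristic zero multiplicity is read off from derivatives, and the derivative of order `m
- j` at `t` is the sum of index `j`. -/
theorem pow_dvd_dpPoly_iff [CharZero K] {N m k : ℕ} (hm : m = N + k) (s : Fin m → K) (t : K) :
    (X - C t) ^ k ∣ dpPoly K m s ↔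
      ∀ j, N < j → j ≤ m → dpSum K (extendSeq s) t j = 0 := by
  have key : ∀ d j, j + d = m → (derivative^[d] (dpPoly K m s)).eval t =
      dpSum K (extendSeq s) t j := by
    intro d j h
    rw [dpPoly_eq_dpSum]
    generalize extendSeq s = v
    rw [← h, iterate_derivative_dpSum_C, eval_dpSum_C]
  have hne : dpPoly K m s ≠ 0 := by
    intro h0
    have := key m 0 (by omega)
    rw [h0] at this
    simp [dpSum, dpow, extendSeq] at this
  rcases Nat.eq_zero_or_pos k with rfl | hk
  · simp only [pow_zero, one_dvd, true_iff]
    intro j h1 h2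
    omega
  rw [← le_rootMultiplicity_iff hne]
  obtain ⟨k, rfl⟩ : ∃ l, k = l + 1 := ⟨k - 1, by omega⟩
  rw [Nat.succ_le_iff, lt_rootMultiplicity_iff_isRoot_iterate_derivative hne]
  constructor
  · intro h j h1 h2
    rw [← key (m - j) j (by omega)]
    exact h (m - j) (by omega)
  · intro h d hd
    rw [IsRoot.def, key d (m - d) (by omega)]
    exact h _ (by omega) (by omega)

end General

/-! ### The coefficients as functions of the root and the free coefficients. -/

/-- The functions `s_j` on the space of pairs (root `x`, first `N` coefficients `s₁, …, s_N`):
for `j > N` they are determined by the vanishing of `∑ s_b x^{(j-b)}`. -/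
def coeffSeq (K : Type*) [Field K] (N : ℕ) (j : ℕ) : (MvPolynomial (Fin N) K)[X] :=
  if j ≤ N then C (extendSeq (fun i => MvPolynomial.X i) j)
  else -∑ b : Fin j, coeffSeq K N b * dpow K X (j - b)
termination_by j
decreasing_by exact b.isLt

section CoeffSeq

variable (K : Type*) [Field K] (N : ℕ)

theorem coeffSeq_of_le {j : ℕ} (h : j ≤ N) :
    coeffSeq K N j = C (extendSeq (fun i => MvPolynomial.X i) j) := by
  rw [coeffSeq, if_pos h]

theorem coeffSeq_zero : coeffSeq K N 0 = 1 := by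
  rw [coeffSeq_of_le K N (Nat.zero_le N), extendSeq_zero, map_one]

theorem coeffSeq_fin (i : Fin N) : coeffSeq K N (i + 1) = C (MvPolynomial.X i) := by
  rw [coeffSeq_of_le K N i.isLt, extendSeq_succ]

theorem dpSum_coeffSeq {j : ℕ} (h : N < j) : dpSum K (coeffSeq K N) X j = 0 := by
  rw [dpSum_eq, coeffSeq, if_neg (by omega), ← Fin.sum_univ_eq_sum_range
    (fun b => coeffSeq K N b * dpow K X (j - b)), add_neg_cancel]

/-- The `(n-N)`-th derivative of the polynomial at its root. -/
def criticalPoly : (MvPolynomial (Fin N) K)[X] := dpSum K (coeffSeq K N) X N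

theorem derivative_coeffSeq_of_le {j : ℕ} (h : j ≤ N) : derivative (coeffSeq K N j) = 0 := by
  rw [coeffSeq_of_le K N h, derivative_C]

/-- Differentiating the relation of index `N + M + 1` expresses the sum of the derivatives as minus
the sum of index `N + M`, which is `w` for `M = 0` and zero otherwise. The sequence `-w (-x)^{(M)}`
solves the same triangular system. -/
theorem derivative_coeffSeq [CharZero K] (M : ℕ) :
    derivative (coeffSeq K N (N + 1 + M)) = -criticalPoly K N * dpow K (-X) M := by
  have key : ∀ M, dpSum K (fun k => derivative (coeffSeq K N (N + 1 + k))) X M =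
      dpSum K (fun k => -criticalPoly K N * dpow K (-X) k) X M := by
    intro M
    have h := congrArg derivative (dpSum_coeffSeq K N (j := N + M + 1) (by omega))
    rw [derivative_dpSum, derivative_zero, dpSum, show N + M + 1 + 1 = N + 1 + (M + 1) by omega,
      Finset.sum_range_add, Finset.sum_eq_zero (s := Finset.range (N + 1)), zero_add] at h
    · have h1 : ∑ x ∈ Finset.range (M + 1), derivative (coeffSeq K N (N + 1 + x)) *
          dpow K X (N + M + 1 - (N + 1 + x)) =
          dpSum K (fun k => derivative (coeffSeq K N (N + 1 + k))) X M :=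
        Finset.sum_congr rfl fun b _ => by
          rw [show N + M + 1 - (N + 1 + b) = M - b by omega]
      rw [h1] at h
      rw [dpSum_mul_left, dpSum_dpow_neg, eq_neg_of_add_eq_zero_left h]
      split_ifs with hM
      · subst hM
        rw [criticalPoly, mul_one, Nat.add_zero]
      · rw [dpSum_coeffSeq K N (by omega), neg_zero, mul_zero]
    · intro b hb
      rw [derivative_coeffSeq_of_le K N (by simpa [Nat.lt_succ_iff] using hb), zero_mul]
  exact eq_of_dpSum_eq M (fun j _ => Or.inr (key j)) M le_rfl

theorem natDegree_dpow_X {A : Type*} [CommRing A] [Algebra K A] (k : ℕ) :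
    (dpow K (X : A[X]) k).natDegree ≤ k := by
  rw [dpow_X]
  exact natDegree_monomial_le _

theorem natDegree_criticalPoly_le : (criticalPoly K N).natDegree ≤ N := by
  rw [criticalPoly, dpSum]
  refine natDegree_sum_le_of_forall_le _ _ fun b hb => ?_
  rw [coeffSeq_of_le K N (by simpa [Nat.lt_succ_iff] using hb)]
  exact (natDegree_C_mul_le _ _).trans ((natDegree_dpow_X K _).trans (Nat.sub_le _ _))

theorem coeff_criticalPoly [CharZero K] : IsUnit ((criticalPoly K N).coeff N) := by
  have h : (criticalPoly K N).coeff N = algebraMap K _ ((Nat.factorial N : K)⁻¹) := by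
    rw [criticalPoly, dpSum, finsetSum_coeff, Finset.sum_eq_single 0]
    · rw [coeffSeq_zero, one_mul, Nat.sub_zero, dpow_X, dividedPow, coeff_monomial_same]
    · intro b hb hb0
      rw [coeffSeq_of_le K N (by simpa [Nat.lt_succ_iff] using hb), coeff_C_mul, dpow_X,
        dividedPow, coeff_monomial_of_ne _ (by
          have := Finset.mem_range.mp hb
          omega), mul_zero]
    · simp
  rw [h]
  exact (IsUnit.mk0 _ (inv_ne_zero (by exact_mod_cast Nat.factorial_ne_zero N))).map _

end CoeffSeq

/-! ### Degrees and leading coefficients in `x`. -/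

section Degree

variable (K : Type*) [Field K] [CharZero K] (N : ℕ)

theorem natDegree_criticalPoly : (criticalPoly K N).natDegree = N :=
  le_antisymm (natDegree_criticalPoly_le K N)
    (le_natDegree_of_ne_zero (coeff_criticalPoly K N).ne_zero)

theorem isUnit_leadingCoeff_criticalPoly : IsUnit (criticalPoly K N).leadingCoeff := by
  rw [leadingCoeff, natDegree_criticalPoly]
  exact coeff_criticalPoly K N

theorem isUnit_algebraMap_factorial {A : Type*} [CommRing A] [Algebra K A] (k : ℕ) :
    IsUnit (algebraMap K A ((Nat.factorial k : K)⁻¹)) :=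
  (IsUnit.mk0 _ (inv_ne_zero (by exact_mod_cast Nat.factorial_ne_zero k))).map _

omit [CharZero K] in
theorem dpow_neg_X_eq {A : Type*} [CommRing A] [Algebra K A] (k : ℕ) :
    dpow K (-X : A[X]) k =
      C ((-1) ^ k * algebraMap K A ((Nat.factorial k : K)⁻¹)) * X ^ k := by
  rw [dpow, neg_pow, Polynomial.algebraMap_apply]
  simp
  ring

theorem natDegree_derivative_coeffSeq (M : ℕ) :
    (derivative (coeffSeq K N (N + 1 + M))).natDegree = N + M ∧
      IsUnit (derivative (coeffSeq K N (N + 1 + M))).leadingCoeff := by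
  have hu : IsUnit ((-1) ^ M *
      algebraMap K (MvPolynomial (Fin N) K) ((Nat.factorial M : K)⁻¹)) :=
    (isUnit_one.neg.pow M).mul (isUnit_algebraMap_factorial K M)
  have hw := isUnit_leadingCoeff_criticalPoly K N
  have hw0 : criticalPoly K N ≠ 0 := fun h => by simp [h] at hw
  rw [derivative_coeffSeq, dpow_neg_X_eq, (fun p q => by ring : ∀ p q :
    (MvPolynomial (Fin N) K)[X], -p * q = -(p * q)), natDegree_neg, leadingCoeff_neg,
    leadingCoeff_mul, leadingCoeff_C_mul_X_pow, natDegree_mul hw0 (by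
      rw [Ne, C_mul_X_pow_eq_monomial, monomial_eq_zero_iff]
      exact hu.ne_zero), natDegree_C_mul_X_pow _ _ hu.ne_zero, natDegree_criticalPoly]
  exact ⟨rfl, (hw.mul hu).neg⟩

theorem natDegree_coeffSeq {j : ℕ} (hj : N < j) : (coeffSeq K N j).natDegree = j := by
  obtain ⟨M, rfl⟩ : ∃ M, j = N + 1 + M := ⟨j - (N + 1), by omega⟩
  have h := natDegree_derivative_coeffSeq K N M
  rw [natDegree_derivative] at h
  -- Truncated subtraction would allow degree `0` when `N = M = 0`; a constant is excluded because
  -- its derivative has no invertible leading coefficient.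
  have h0 : (coeffSeq K N (N + 1 + M)).natDegree ≠ 0 := by
    intro h0
    rw [natDegree_eq_zero] at h0
    obtain ⟨x, hx⟩ := h0
    simp [← hx] at h
  omega

theorem isUnit_leadingCoeff_coeffSeq {j : ℕ} (hj : N < j) :
    IsUnit (coeffSeq K N j).leadingCoeff := by
  have hd := natDegree_coeffSeq K N hj
  obtain ⟨M, rfl⟩ : ∃ M, j = N + 1 + M := ⟨j - (N + 1), by omega⟩
  have h := natDegree_derivative_coeffSeq K N M
  rw [leadingCoeff, h.1, coeff_derivative, show N + M + 1 = N + 1 + M by omega] at h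
  rw [leadingCoeff, hd]
  exact isUnit_of_mul_isUnit_left h.2

end Degree

/-! ### Reduction by degree and common denominators. -/

section Reduction

variable {A : Type*} [CommRing A]

/-- If a module of polynomials has elements with invertible leading coefficient in every degree
`≥ d`, then every polynomial has degree `< d` modulo it. -/
theorem exists_degree_lt_sub_mem (M : Submodule A A[X]) (d : ℕ)
    (h : ∀ e, d ≤ e → ∃ p ∈ M, p.natDegree = e ∧ IsUnit p.leadingCoeff) (g : A[X]) :
    ∃ r : A[X], r.degree < d ∧ g - r ∈ M := by
  by_cases hA : Subsingleton A
  · exact ⟨0, by simp, by simp [Subsingleton.elim g 0]⟩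
  rw [not_subsingleton_iff_nontrivial] at hA
  suffices H : ∀ e : ℕ, ∀ g : A[X], g.degree < e → ∃ r : A[X], r.degree < d ∧ g - r ∈ M from
    H (g.natDegree + 1) g (degree_le_natDegree.trans_lt (by exact_mod_cast Nat.lt_succ_self _))
  intro e
  induction e with
  | zero =>
    intro g hg
    have : g = 0 := by simpa using hg
    exact ⟨0, by simp, by simp [this]⟩
  | succ e ih =>
    intro g hg
    rcases lt_or_ge e d with hed | hed
    · exact ⟨g, hg.trans_le (by exact_mod_cast hed), by simp⟩
    obtain ⟨p, hp, hpd, u, hu⟩ := h e hed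
    have hlt : (g - C (g.coeff e * ↑u⁻¹) * p).degree < e := by
      rw [degree_lt_iff_coeff_zero]
      intro k hk
      rw [coeff_sub, coeff_C_mul]
      rcases hk.eq_or_lt with rfl | hk
      · have : p.coeff e = u := by rw [hu, leadingCoeff, hpd]
        rw [this, mul_assoc, Units.inv_mul, mul_one, sub_self]
      · rw [coeff_eq_zero_of_natDegree_lt (hpd.trans_lt hk),
          coeff_eq_zero_of_degree_lt (hg.trans_le (by exact_mod_cast hk)), mul_zero, sub_zero]
    obtain ⟨r, hr, hm⟩ := ih _ hlt
    refine ⟨r, hr, ?_⟩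
    have := add_mem hm (M.smul_mem (g.coeff e * ↑u⁻¹) hp)
    rw [smul_eq_C_mul] at this
    convert this using 1
    ring

/-- If a subalgebra of `A[X]` has elements with invertible leading coefficient in every large
degree, then every polynomial has a nonzero multiple in it. -/
theorem exists_mul_mem [IsDomain A] (S : Subalgebra A A[X]) (d : ℕ)
    (h : ∀ e, d ≤ e → ∃ p ∈ S, p.natDegree = e ∧ IsUnit p.leadingCoeff) (g : A[X]) :
    ∃ q ∈ S, q ≠ 0 ∧ q * g ∈ S := by
  -- Degree `d + 1` makes `W` nonconstant, hence transcendental over `A`.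
  obtain ⟨W, hWS, hWd, -⟩ := h (d + 1) (Nat.le_succ d)
  choose r hr hrm using fun k : ℕ =>
    exists_degree_lt_sub_mem (Subalgebra.toSubmodule S) d h (W ^ k * g)
  let f : (Fin (d + 1) → A) →ₗ[A] (Fin d → A) :=
    { toFun := fun a i => ∑ k, a k * (r k).coeff i
      map_add' := fun a b => by
        ext i
        simp [add_mul, Finset.sum_add_distrib]
      map_smul' := fun c a => by
        ext i
        simp [Finset.mul_sum, mul_assoc] }
  -- The `d + 1` remainders of `W ^ k * g` live in a free module of rank `d`, so they satisfy a
  -- linear relation `a`; the multiplier sought is `∑ a_k W ^ k`.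
  have hf : ¬ Function.Injective f := fun hf => by
    have := card_le_of_injective A f hf
    simp at this
  rw [← LinearMap.ker_eq_bot, Submodule.eq_bot_iff] at hf
  push Not at hf
  obtain ⟨a, ha, ha0⟩ := hf
  have hr0 : ∑ k, C (a k) * r k = 0 := by
    ext i
    rw [finsetSum_coeff, coeff_zero]
    rcases lt_or_ge i d with hi | hi
    · have := congrFun (LinearMap.mem_ker.mp ha) ⟨i, hi⟩
      simpa [f] using this
    · exact Finset.sum_eq_zero fun k _ => by
        rw [coeff_C_mul, coeff_eq_zero_of_degree_lt ((hr k).trans_le (by exact_mod_cast hi)),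
          mul_zero]
  have hC : ∀ c, C c ∈ S := fun c => S.algebraMap_mem c
  refine ⟨∑ k, C (a k) * W ^ (k : ℕ), sum_mem fun k _ => mul_mem (hC _) (pow_mem hWS _), ?_, ?_⟩
  · intro h0
    apply ha0
    have hP : (∑ k : Fin (d + 1), C (a k) * X ^ (k : ℕ) : A[X]) = 0 := by
      by_contra hne
      have h1 : (∑ k : Fin (d + 1), C (a k) * X ^ (k : ℕ) : A[X]).comp W = 0 := by
        simpa [comp, eval₂_finsetSum] using h0
      rcases comp_eq_zero_iff.mp h1 with h1 | h1
      · exact hne h1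
      · rw [h1.2, natDegree_C] at hWd
        omega
    ext1 k
    have := congrArg (fun p => p.coeff (k : ℕ)) hP
    simpa [finsetSum_coeff, coeff_X_pow, Fin.val_inj] using this
  · have : (∑ k, C (a k) * W ^ (k : ℕ)) * g =
        ∑ k : Fin (d + 1), C (a k) * (W ^ (k : ℕ) * g - r k) := by
      simp_rw [mul_sub, Finset.sum_sub_distrib, hr0, sub_zero, Finset.sum_mul, mul_assoc]
    rw [this]
    exact sum_mem fun k _ => mul_mem (hC _) (hrm k)

end Reduction

/-! ### Parametrization of the caustics and their ideals. -/

section Theta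

variable (K : Type*) [Field K] (N : ℕ)

/-- The homomorphism `s_j ↦ coeffSeq j`. -/
def coeffHom (m : ℕ) : MvPolynomial (Fin m) K →ₐ[K] (MvPolynomial (Fin N) K)[X] :=
  MvPolynomial.aeval fun i => coeffSeq K N (i + 1)

/-- Evaluation at a point `(a, t)`. -/
def evalPoint {K : Type*} [Field K] {N : ℕ} (a : Fin N → K) (t : K) :
    (MvPolynomial (Fin N) K)[X] →ₐ[K] K :=
  Polynomial.eval₂AlgHom (MvPolynomial.aeval a) t fun _ => mul_comm _ _

variable {K N}

theorem evalPoint_C (a : Fin N → K) (t : K) (p : MvPolynomial (Fin N) K) :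
    evalPoint a t (C p) = MvPolynomial.aeval a p :=
  eval₂_C _ _

theorem evalPoint_X (a : Fin N → K) (t : K) : evalPoint a t X = t :=
  eval₂_X _ _

theorem eq_zero_of_evalPoint [Infinite K] (g : (MvPolynomial (Fin N) K)[X])
    (h : ∀ a t, evalPoint a t g = 0) : g = 0 := by
  ext1 j
  refine MvPolynomial.funext fun a => ?_
  have hs : g.map (MvPolynomial.eval a) = 0 := by
    refine Polynomial.funext fun t => ?_
    have e : ((MvPolynomial.aeval a : _ →ₐ[K] K) : _ →+* K) = MvPolynomial.eval a := by
      ext <;> simp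
    rw [eval_zero, ← h a t, eval_map, ← e]
    rfl
  simpa using congrArg (fun q => q.coeff j) hs

/-- A sequence satisfying the recursion of `coeffSeq` is an image of `coeffSeq`. -/
theorem map_coeffSeq_eq {B : Type*} [CommRing B] [Algebra K B]
    (f : (MvPolynomial (Fin N) K)[X] →ₐ[K] B) {m : ℕ} (s : Fin m → B)
    (h1 : ∀ i : Fin m, (h : (i : ℕ) < N) → s i = f (C (MvPolynomial.X ⟨i, h⟩)))
    (h2 : ∀ j, N < j → j ≤ m → dpSum K (extendSeq s) (f X) j = 0) (i : Fin m) :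
    f (coeffSeq K N (i + 1)) = s i := by
  rw [← extendSeq_succ s]
  refine eq_of_dpSum_eq (K := K) (v := fun b => f (coeffSeq K N b)) (r := f X) m
    (fun j hj => ?_) (i + 1) i.isLt
  rcases lt_or_ge N j with hN | hN
  · right
    rw [h2 j hN hj, ← map_dpSum, dpSum_coeffSeq K N hN, map_zero]
  · left
    match j with
    | 0 => simp [coeffSeq_zero, extendSeq_zero]
    | j + 1 =>
      rw [extendSeq_succ s ⟨j, hj⟩, h1 ⟨j, hj⟩ hN, coeffSeq_fin K N ⟨j, hN⟩]

theorem evalPoint_coeffHom {m : ℕ} (a : Fin N → K) (t : K) (p : MvPolynomial (Fin m) K) :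
    evalPoint a t (coeffHom K N m p) =
      MvPolynomial.aeval (fun i : Fin m => evalPoint a t (coeffSeq K N (i + 1))) p := by
  rw [coeffHom, ← AlgHom.comp_apply, MvPolynomial.comp_aeval]

theorem evalPoint_mem_caustic [CharZero K] {m k : ℕ} (hm : m = N + k) (a : Fin N → K) (t : K) :
    (fun i : Fin m => evalPoint a t (coeffSeq K N (i + 1))) ∈ caustic K m k := by
  refine ⟨t, (pow_dvd_dpPoly_iff hm _ t).mpr fun j hj hjm => ?_⟩
  have h := congrArg (evalPoint a t) (dpSum_coeffSeq K N hj)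
  rw [map_dpSum, evalPoint_X, map_zero] at h
  rw [← h]
  refine dpSum_congr _ _ fun b hb => ?_
  match b with
  | 0 => simp [coeffSeq_zero, extendSeq_zero]
  | b + 1 => exact extendSeq_succ _ ⟨b, by omega⟩

/-- The caustic is parametrized by a root and the first `N` coefficients. -/
theorem exists_evalPoint_of_mem_caustic [CharZero K] {m k : ℕ} (hm : m = N + k) {s : Fin m → K}
    (hs : s ∈ caustic K m k) :
    ∃ a t, (fun i : Fin m => evalPoint a t (coeffSeq K N (i + 1))) = s := by
  obtain ⟨t, ht⟩ := hs
  refine ⟨fun i => s (Fin.castLE (by omega) i), t, funext fun i => ?_⟩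
  refine map_coeffSeq_eq _ s (fun i h => ?_) (fun j h1 h2 => ?_) i
  · rw [evalPoint_C, MvPolynomial.aeval_X]
    rfl
  · rw [evalPoint_X]
    exact (pow_dvd_dpPoly_iff hm s t).mp ht j h1 h2

/-- The parametrization covers exactly the caustic, and over an infinite field a polynomial
vanishing at all parameters is zero. -/
theorem mem_vanishingIdeal_caustic_iff [CharZero K] {m k : ℕ} (hm : m = N + k)
    (p : MvPolynomial (Fin m) K) :
    p ∈ MvPolynomial.vanishingIdeal K (caustic K m k) ↔ coeffHom K N m p = 0 := by
  rw [MvPolynomial.mem_vanishingIdeal_iff]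
  constructor
  · intro h
    refine eq_zero_of_evalPoint _ fun a t => ?_
    rw [evalPoint_coeffHom]
    exact h _ (evalPoint_mem_caustic hm a t)
  · intro h s hs
    obtain ⟨a, t, rfl⟩ := exists_evalPoint_of_mem_caustic hm hs
    rw [← evalPoint_coeffHom, h, map_zero]

end Theta

/-! ### The increasing subalgebras and where they stabilize. -/

section Subalgebras

variable (K : Type*) [Field K] (N : ℕ)

/-- The subalgebra generated by the coefficients `s_j`, `j ≤ m`. -/
def coeffSubalgebra (m : ℕ) : Subalgebra (MvPolynomial (Fin N) K) (MvPolynomial (Fin N) K)[X] :=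
  Algebra.adjoin _ (coeffSeq K N '' Set.Iic m)

/-- The polynomials whose derivative is divisible by `criticalPoly`. -/
def swallowtail : Subalgebra (MvPolynomial (Fin N) K) (MvPolynomial (Fin N) K)[X] where
  carrier := {g | criticalPoly K N ∣ derivative g}
  mul_mem' {a b} ha hb := by
    change _ ∣ derivative (a * b)
    rw [derivative_mul]
    exact dvd_add (Dvd.dvd.mul_right ha _) (Dvd.dvd.mul_left hb _)
  add_mem' {a b} ha hb := by
    change _ ∣ derivative (a + b)
    rw [derivative_add]
    exact dvd_add ha hb
  algebraMap_mem' r := by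
    change _ ∣ derivative (C r)
    rw [derivative_C]
    exact dvd_zero _

variable {K N}

theorem mem_swallowtail {g : (MvPolynomial (Fin N) K)[X]} :
    g ∈ swallowtail K N ↔ criticalPoly K N ∣ derivative g := Iff.rfl

theorem coeffSeq_mem_coeffSubalgebra {j m : ℕ} (h : j ≤ m) :
    coeffSeq K N j ∈ coeffSubalgebra K N m :=
  Algebra.subset_adjoin ⟨j, h, rfl⟩

theorem coeffSubalgebra_mono {m m' : ℕ} (h : m ≤ m') :
    coeffSubalgebra K N m ≤ coeffSubalgebra K N m' :=
  Algebra.adjoin_mono (Set.image_mono (Set.Iic_subset_Iic.mpr h))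

theorem coeffHom_rename {m : ℕ} (h : N ≤ m) (a : MvPolynomial (Fin N) K) :
    coeffHom K N m (MvPolynomial.rename (Fin.castLE h) a) = C a := by
  have : (coeffHom K N m).comp (MvPolynomial.rename (Fin.castLE h)) = CAlgHom := by
    refine MvPolynomial.algHom_ext fun i => ?_
    simp [coeffHom, coeffSeq_fin]
  exact DFunLike.congr_fun this a

theorem range_coeffHom {m : ℕ} (h : N ≤ m) :
    Set.range (coeffHom K N m) = (coeffSubalgebra K N m : Set _) := by
  ext g
  rw [SetLike.mem_coe]
  constructor
  · rintro ⟨p, rfl⟩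
    induction p using MvPolynomial.induction_on with
    | C a =>
      have : coeffHom K N m (MvPolynomial.C a) = C (MvPolynomial.C a) := by
        rw [coeffHom, MvPolynomial.aeval_C]
        rfl
      rw [this]
      exact Subalgebra.algebraMap_mem _ _
    | add p q hp hq =>
      rw [map_add]
      exact add_mem hp hq
    | mul_X p i hp =>
      rw [map_mul]
      refine mul_mem hp ?_
      rw [coeffHom, MvPolynomial.aeval_X]
      exact coeffSeq_mem_coeffSubalgebra i.isLt
  · intro hg
    change g ∈ (coeffHom K N m).range
    induction hg using Algebra.adjoin_induction with
    | mem g hg =>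
      obtain ⟨j, hj, rfl⟩ := hg
      match j, hj with
      | 0, _ =>
        rw [coeffSeq_zero]
        exact one_mem _
      | j + 1, hj => exact ⟨MvPolynomial.X ⟨j, hj⟩, by simp [coeffHom]⟩
    | algebraMap a => exact ⟨_, coeffHom_rename h a⟩
    | add p q _ _ hp hq => exact add_mem hp hq
    | mul p q _ _ hp hq => exact mul_mem hp hq

variable [CharZero K]

theorem coeffSeq_mem_swallowtail (j : ℕ) : coeffSeq K N j ∈ swallowtail K N := by
  rw [mem_swallowtail]
  rcases lt_or_ge N j with h | h
  · obtain ⟨M, rfl⟩ : ∃ M, j = N + 1 + M := ⟨j - (N + 1), by omega⟩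
    rw [derivative_coeffSeq]
    exact Dvd.intro (-dpow K (-X) M) (by ring)
  · rw [derivative_coeffSeq_of_le K N h]
    exact dvd_zero _

theorem coeffSubalgebra_le_swallowtail (m : ℕ) : coeffSubalgebra K N m ≤ swallowtail K N := by
  rw [coeffSubalgebra, Algebra.adjoin_le_iff]
  rintro _ ⟨j, -, rfl⟩
  exact coeffSeq_mem_swallowtail j

theorem natDegree_mul_of_isUnit_leadingCoeff {A : Type*} [CommRing A] [IsDomain A] {p q : A[X]}
    (hp : IsUnit p.leadingCoeff) (hq : IsUnit q.leadingCoeff) :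
    (p * q).natDegree = p.natDegree + q.natDegree ∧ IsUnit (p * q).leadingCoeff := by
  rw [natDegree_mul (leadingCoeff_ne_zero.mp hp.ne_zero) (leadingCoeff_ne_zero.mp hq.ne_zero),
    leadingCoeff_mul]
  exact ⟨rfl, hp.mul hq⟩

/-- Write `e = q(N+1) + (N+1+r)` with `r ≤ N`, and multiply `q` copies of the generator of degree
`N+1` by the one of degree `N+1+r`. The largest index needed is `2N+1`. -/
theorem exists_mem_coeffSubalgebra_natDegree {e : ℕ} (he : N + 1 ≤ e) :
    ∃ p ∈ coeffSubalgebra K N (2 * N + 1), p.natDegree = e ∧ IsUnit p.leadingCoeff := by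
  have hW := isUnit_leadingCoeff_coeffSeq K N (Nat.lt_succ_self N)
  have hWd := natDegree_coeffSeq K N (Nat.lt_succ_self N)
  have hWm : coeffSeq K N (N + 1) ∈ coeffSubalgebra K N (2 * N + 1) :=
    coeffSeq_mem_coeffSubalgebra (by omega)
  obtain ⟨q, hq⟩ : ∃ q, e / (N + 1) = q + 1 :=
    ⟨e / (N + 1) - 1, by have := Nat.div_pos he (Nat.succ_pos N); omega⟩
  have hr : e % (N + 1) < N + 1 := Nat.mod_lt _ (Nat.succ_pos N)
  have he' := Nat.div_add_mod e (N + 1)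
  rw [hq] at he'
  have hj : N < N + 1 + e % (N + 1) := by omega
  have hWq : IsUnit (coeffSeq K N (N + 1) ^ q).leadingCoeff := by
    rw [leadingCoeff_pow]
    exact hW.pow q
  have h := natDegree_mul_of_isUnit_leadingCoeff hWq (isUnit_leadingCoeff_coeffSeq K N hj)
  refine ⟨_, mul_mem (pow_mem hWm q) (coeffSeq_mem_coeffSubalgebra (by omega)), ?_, h.2⟩
  rw [h.1, natDegree_pow, hWd, natDegree_coeffSeq K N hj]
  linarith

/-- Every `e ≥ (N+1)²` lies in the semigroup generated by `N+1` and `N+2`: take `e mod (N+1)` copies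
of `N+2`. -/
theorem exists_mem_coeffSubalgebra_natDegree' {e : ℕ} (he : (N + 1) * (N + 1) ≤ e) :
    ∃ p ∈ coeffSubalgebra K N (N + 2), p.natDegree = e ∧ IsUnit p.leadingCoeff := by
  have hW := isUnit_leadingCoeff_coeffSeq K N (j := N + 1) (by omega)
  have hZ := isUnit_leadingCoeff_coeffSeq K N (j := N + 2) (by omega)
  have hr : e % (N + 1) < N + 1 := Nat.mod_lt _ (Nat.succ_pos N)
  have hq : N + 1 ≤ e / (N + 1) := (Nat.le_div_iff_mul_le (Nat.succ_pos N)).mpr he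
  have he' := Nat.div_add_mod e (N + 1)
  obtain ⟨q, hq⟩ : ∃ q, e / (N + 1) = q + e % (N + 1) :=
    ⟨e / (N + 1) - e % (N + 1), by omega⟩
  set r := e % (N + 1)
  have hWq : IsUnit (coeffSeq K N (N + 1) ^ q).leadingCoeff := by
    rw [leadingCoeff_pow]
    exact hW.pow q
  have hZr : IsUnit (coeffSeq K N (N + 2) ^ r).leadingCoeff := by
    rw [leadingCoeff_pow]
    exact hZ.pow r
  have h := natDegree_mul_of_isUnit_leadingCoeff hWq hZr
  refine ⟨_, mul_mem (pow_mem (coeffSeq_mem_coeffSubalgebra (by omega)) q)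
    (pow_mem (coeffSeq_mem_coeffSubalgebra le_rfl) r), ?_, h.2⟩
  rw [h.1, natDegree_pow, natDegree_pow, natDegree_coeffSeq K N (by omega),
    natDegree_coeffSeq K N (by omega), ← he', hq]
  ring

/-- The derivative has degree below `N`, the degree of `w`, so divisibility by `w` forces it to
vanish. -/
theorem eq_C_of_mem_swallowtail {r : (MvPolynomial (Fin N) K)[X]} (hr : r ∈ swallowtail K N)
    (hd : r.degree < (N + 1 : ℕ)) : ∃ a, r = C a := by
  obtain ⟨h, hh⟩ := mem_swallowtail.mp hr
  have hw := isUnit_leadingCoeff_criticalPoly K N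
  have h0 : derivative r = 0 := by
    by_contra hne
    have hh0 : h ≠ 0 := by
      rintro rfl
      exact hne (by rw [hh, mul_zero])
    have h1 := congrArg natDegree hh
    rw [natDegree_mul (leadingCoeff_ne_zero.mp hw.ne_zero) hh0, natDegree_criticalPoly] at h1
    have h2 : r.natDegree ≠ 0 := by
      intro h2
      rw [natDegree_eq_zero] at h2
      obtain ⟨a, rfl⟩ := h2
      exact hne derivative_C
    have h3 := natDegree_derivative_lt h2
    have h4 : r.natDegree < N + 1 := by
      rw [natDegree_lt_iff_degree_lt (fun h => h2 (by rw [h, natDegree_zero]))]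
      exact hd
    omega
  exact ⟨_, eq_C_of_derivative_eq_zero h0⟩

/-- Subtracting elements of the subalgebra lowers the degree to at most `N`; what is left is still
in `swallowtail`, hence free of `x`. -/
theorem coeffSubalgebra_eq_swallowtail {m : ℕ} (hm : 2 * N + 1 ≤ m) :
    coeffSubalgebra K N m = swallowtail K N := by
  refine le_antisymm (coeffSubalgebra_le_swallowtail m) fun g hg => ?_
  obtain ⟨r, hr, hgr⟩ := exists_degree_lt_sub_mem
    (Subalgebra.toSubmodule (coeffSubalgebra K N (2 * N + 1))) (N + 1)
    (fun e he => exists_mem_coeffSubalgebra_natDegree he) g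
  have hgr' : g - r ∈ coeffSubalgebra K N (2 * N + 1) := hgr
  have hrS : r ∈ swallowtail K N := by
    simpa using sub_mem hg (coeffSubalgebra_le_swallowtail _ hgr')
  obtain ⟨a, rfl⟩ := eq_C_of_mem_swallowtail hrS hr
  have := add_mem hgr' (Subalgebra.algebraMap_mem (coeffSubalgebra K N (2 * N + 1)) a)
  rw [← C_eq_algebraMap, sub_add_cancel] at this
  exact coeffSubalgebra_mono hm this

/-- Specialization of all free coefficients to zero. -/
def specialize (K : Type*) [Field K] (N : ℕ) :
    (MvPolynomial (Fin N) K)[X] →+* K[X] :=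
  mapRingHom (MvPolynomial.eval 0)

omit [CharZero K] in
theorem X_pow_dvd_specialize_criticalPoly : X ^ N ∣ specialize K N (criticalPoly K N) := by
  rw [criticalPoly, dpSum, map_sum]
  refine Finset.dvd_sum fun b hb => ?_
  match b with
  | 0 =>
    rw [coeffSeq_zero, one_mul, Nat.sub_zero, dpow, map_mul, map_pow]
    rw [show specialize K N X = X by simp [specialize]]
    exact dvd_mul_left _ _
  | b + 1 =>
    have hb' : b < N := by simpa using hb
    rw [coeffSeq_fin K N ⟨b, hb'⟩, map_mul]
    simp [specialize]

/-- At the origin `w` becomes a multiple of `x^N`, so the derivative has no terms below `x^N`. -/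
theorem coeff_specialize_eq_zero {g : (MvPolynomial (Fin N) K)[X]} (hg : g ∈ swallowtail K N)
    {i : ℕ} (h1 : 1 ≤ i) (h2 : i ≤ N) : (specialize K N g).coeff i = 0 := by
  have h : X ^ N ∣ derivative (specialize K N g) := by
    rw [specialize, coe_mapRingHom, derivative_map]
    exact X_pow_dvd_specialize_criticalPoly.trans (map_dvd (specialize K N) hg)
  rw [X_pow_dvd_iff] at h
  obtain ⟨i, rfl⟩ : ∃ l, i = l + 1 := ⟨i - 1, by omega⟩
  have := h i (by omega)
  rw [coeff_derivative] at this
  exact (mul_eq_zero.mp this).resolve_right (by exact_mod_cast Nat.succ_ne_zero i)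

/-- After specialization no element of the subalgebra has an `x^(m+1)` term. Generators have too
small a degree; in a product, exponents `a + b = m + 1 ≤ 2N + 1` are either `0` and `m + 1` or
include one in the gap `1, …, N`. -/
theorem coeffSeq_notMem_coeffSubalgebra {m : ℕ} (h1 : N ≤ m) (h2 : m ≤ 2 * N) :
    coeffSeq K N (m + 1) ∉ coeffSubalgebra K N m := by
  have key : ∀ g ∈ coeffSubalgebra K N m, (specialize K N g).coeff (m + 1) = 0 := by
    intro g hg
    induction hg using Algebra.adjoin_induction with
    | mem g hg =>
      obtain ⟨j, hj, rfl⟩ := hg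
      have hd : (coeffSeq K N j).natDegree ≤ j := by
        rcases lt_or_ge N j with h | h
        · exact (natDegree_coeffSeq K N h).le
        · rw [coeffSeq_of_le K N h, natDegree_C]
          exact Nat.zero_le _
      rw [specialize, coe_mapRingHom, coeff_map,
        coeff_eq_zero_of_natDegree_lt (by have := Set.mem_Iic.mp hj; omega), map_zero]
    | algebraMap a =>
      rw [specialize, coe_mapRingHom, coeff_map, ← C_eq_algebraMap, coeff_C,
        if_neg (Nat.succ_ne_zero m), map_zero]
    | add p q _ _ hp hq => rw [map_add, coeff_add, hp, hq, add_zero]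
    | mul p q hpm hqm hp hq =>
      have hpS := coeffSubalgebra_le_swallowtail m hpm
      have hqS := coeffSubalgebra_le_swallowtail m hqm
      rw [map_mul, coeff_mul]
      refine Finset.sum_eq_zero fun ⟨a, b⟩ hab => ?_
      have hab' : a + b = m + 1 := Finset.HasAntidiagonal.mem_antidiagonal.mp hab
      rcases Nat.eq_zero_or_pos a with rfl | ha
      · rw [zero_add] at hab'
        rw [hab', hq, mul_zero]
      rcases Nat.eq_zero_or_pos b with rfl | hb
      · rw [add_zero] at hab'
        rw [hab', hp, zero_mul]
      rcases le_or_gt a N with haN | haN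
      · rw [coeff_specialize_eq_zero hpS ha haN, zero_mul]
      · rw [coeff_specialize_eq_zero hqS hb (by omega), mul_zero]
  intro h
  have h0 := key _ h
  have hu := (isUnit_leadingCoeff_coeffSeq K N (j := m + 1) (by omega)).map
    (MvPolynomial.eval (0 : Fin N → K))
  rw [leadingCoeff, natDegree_coeffSeq K N (by omega)] at hu
  rw [specialize, coe_mapRingHom, coeff_map] at h0
  exact hu.ne_zero h0

theorem coeffSubalgebra_eq_succ_iff {m : ℕ} (h1 : N ≤ m) :
    coeffSubalgebra K N m = coeffSubalgebra K N (m + 1) ↔ 2 * N + 1 ≤ m := by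
  constructor
  · intro h
    by_contra hm
    refine coeffSeq_notMem_coeffSubalgebra (K := K) h1 (by omega) ?_
    rw [h]
    exact coeffSeq_mem_coeffSubalgebra le_rfl
  · intro h
    rw [coeffSubalgebra_eq_swallowtail h, coeffSubalgebra_eq_swallowtail (by omega)]

end Subalgebras

/-! ### Coordinate rings of caustics as subrings. -/

section CausticEmbedding

variable {K : Type*} [Field K] [CharZero K] {N : ℕ}

/-- The coordinate ring of a caustic as a subring of that of its normalization. -/
def causticEmbedding {m k : ℕ} (hm : m = N + k) :
    CausticRing K m k →ₐ[K] (MvPolynomial (Fin N) K)[X] :=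
  Ideal.Quotient.liftₐ _ (coeffHom K N m) fun p hp => (mem_vanishingIdeal_caustic_iff hm p).mp hp

/-- The class of a polynomial in the coordinate ring of a caustic. -/
def causticMk (K : Type*) [Field K] (m k : ℕ) : MvPolynomial (Fin m) K →ₐ[K] CausticRing K m k :=
  Ideal.Quotient.mkₐ K _

omit [CharZero K] in
theorem causticMk_surjective {m k : ℕ} : Function.Surjective (causticMk K m k) :=
  Ideal.Quotient.mk_surjective

theorem causticEmbedding_mk {m k : ℕ} (hm : m = N + k) (p : MvPolynomial (Fin m) K) :
    causticEmbedding hm (causticMk K m k p) = coeffHom K N m p := rfl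

theorem diffPullback_mk {m k d : ℕ} (p : MvPolynomial (Fin m) K) :
    diffPullback K m k d (causticMk K m k p) =
      causticMk K (m + d) (k + d) (MvPolynomial.rename (Fin.castAdd d) p) := rfl

theorem causticEmbedding_injective {m k : ℕ} (hm : m = N + k) :
    Function.Injective (causticEmbedding (K := K) hm) := by
  rw [injective_iff_map_eq_zero]
  intro g hg
  obtain ⟨p, rfl⟩ := causticMk_surjective g
  rw [causticEmbedding_mk, ← mem_vanishingIdeal_caustic_iff hm] at hg
  exact Ideal.Quotient.eq_zero_iff_mem.mpr hg

theorem range_causticEmbedding {m k : ℕ} (hm : m = N + k) :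
    Set.range (causticEmbedding (K := K) hm) = (coeffSubalgebra K N m : Set _) := by
  rw [← range_coeffHom (by omega), ← causticMk_surjective.range_comp]
  rfl

theorem causticEmbedding_diffPullback {m k d : ℕ} (hm : m = N + k) (hm' : m + d = N + (k + d))
    (g : CausticRing K m k) :
    causticEmbedding hm' (diffPullback K m k d g) = causticEmbedding hm g := by
  obtain ⟨p, rfl⟩ := causticMk_surjective g
  rw [diffPullback_mk, causticEmbedding_mk, causticEmbedding_mk, coeffHom, coeffHom,
    MvPolynomial.aeval_rename]
  rfl

theorem diffPullback_bijective_iff {m k : ℕ} (hm : m = N + k) :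
    Function.Bijective (diffPullback K m k 1) ↔ 2 * N + 1 ≤ m := by
  have hm' : m + 1 = N + (k + 1) := by omega
  have hcomp : ⇑(causticEmbedding (K := K) hm') ∘ diffPullback K m k 1 = causticEmbedding hm :=
    funext (causticEmbedding_diffPullback hm hm')
  have hinj : Function.Injective (diffPullback K m k 1) := by
    have := causticEmbedding_injective (K := K) hm
    rw [← hcomp] at this
    exact this.of_comp
  rw [← coeffSubalgebra_eq_succ_iff (K := K) (N := N) (by omega), ← SetLike.coe_set_eq,
    ← range_causticEmbedding hm, ← range_causticEmbedding hm', ← hcomp, Set.range_comp]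
  constructor
  · intro h
    rw [h.surjective.range_eq, Set.image_univ]
  · intro h
    refine ⟨hinj, Set.range_eq_univ.mp ?_⟩
    rw [← Set.image_univ (f := causticEmbedding hm')] at h
    exact (causticEmbedding_injective hm').image_injective h

/-- A homomorphism over the coordinate ring of the discriminant is the inclusion. -/
theorem eq_causticEmbedding {k d : ℕ} (hm : N + 2 = N + k) (hm' : N + 2 + d = N + (k + d))
    (ψ : CausticRing K (N + 2 + d) (k + d) →ₐ[K] (MvPolynomial (Fin N) K)[X])
    (hψ : ∀ g, ψ (diffPullback K (N + 2) k d g) = causticEmbedding hm g) :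
    ψ = causticEmbedding hm' := by
  ext1 g
  have hS : ∀ p ∈ coeffSubalgebra K N (N + 2), ∃ r, causticEmbedding hm' r = p ∧ ψ r = p := by
    intro p hp
    rw [← SetLike.mem_coe, ← range_causticEmbedding hm] at hp
    obtain ⟨r, rfl⟩ := hp
    exact ⟨_, causticEmbedding_diffPullback hm hm' r, hψ r⟩
  -- A denominator `q` from the ring of the discriminant, where both maps agree; cancelling it in
  -- the domain gives agreement on `g`.
  obtain ⟨q, hq, hq0, hqg⟩ := exists_mul_mem (coeffSubalgebra K N (N + 2)) _
    (fun e he => exists_mem_coeffSubalgebra_natDegree' he) (causticEmbedding hm' g)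
  obtain ⟨r, hr, hr'⟩ := hS q hq
  obtain ⟨t, ht, ht'⟩ := hS _ hqg
  have hrt : r * g = t := causticEmbedding_injective hm' (by rw [map_mul, hr, ht])
  have h := congrArg ψ hrt
  rw [map_mul, hr', ht'] at h
  exact mul_left_cancel₀ hq0 h

end CausticEmbedding

/-! ### The incidence variety as an affine space. -/

section Incidence

variable {K : Type*} [Field K] {N : ℕ}

theorem map_extendSeq {A B : Type*} [CommRing A] [CommRing B] (f : A →+* B) {m : ℕ}
    (s : Fin m → A) (b : ℕ) : f (extendSeq s b) = extendSeq (fun i => f (s i)) b := by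
  match b with
  | 0 => exact map_one f
  | b + 1 =>
    rw [extendSeq, extendSeq]
    split_ifs
    · rfl
    · exact map_zero f

variable (K N) in
/-- The homomorphism `s_j ↦ coeffSeq j`, `x ↦ x`. -/
def incidenceHom : (MvPolynomial (Fin (N + 2)) K)[X] →ₐ[K] (MvPolynomial (Fin N) K)[X] :=
  eval₂AlgHom (coeffHom K N (N + 2)) X fun _ => mul_comm _ _

theorem incidenceHom_C (p : MvPolynomial (Fin (N + 2)) K) :
    incidenceHom K N (C p) = coeffHom K N (N + 2) p :=
  eval₂_C _ _

theorem incidenceHom_X : incidenceHom K N X = X :=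
  eval₂_X _ _

/-- The polynomial `x^{(j)} + s₁ x^{(j-1)} + ⋯ + s_j` over `K[s₁, …, s_n]`. -/
def truncatedUnivPoly (K : Type*) [Field K] (n j : ℕ) : (MvPolynomial (Fin n) K)[X] :=
  dpSum K (fun b => C (extendSeq (fun i => MvPolynomial.X i) b)) X j

/-- The class of a polynomial in the coordinate ring of the incidence variety. -/
def incidenceMk (K : Type*) [Field K] (n : ℕ) :
    (MvPolynomial (Fin n) K)[X] →ₐ[K] IncidenceRing K n :=
  Ideal.Quotient.mkₐ K _

theorem incidenceMk_surjective {n : ℕ} : Function.Surjective (incidenceMk K n) :=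
  Ideal.Quotient.mk_surjective

theorem incidenceHom_dpSum {j : ℕ} (h1 : N < j) (h2 : j ≤ N + 2) :
    incidenceHom K N (truncatedUnivPoly K (N + 2) j) = 0 := by
  rw [truncatedUnivPoly, map_dpSum, incidenceHom_X, ← dpSum_coeffSeq K N h1]
  refine dpSum_congr _ _ fun b hb => ?_
  rw [incidenceHom_C]
  match b with
  | 0 => rw [extendSeq_zero, map_one, coeffSeq_zero]
  | b + 1 =>
    rw [extendSeq_succ _ (⟨b, by omega⟩ : Fin (N + 2)), coeffHom, MvPolynomial.aeval_X]

theorem univPoly_eq_truncated (n : ℕ) :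
    univPoly K n = truncatedUnivPoly K n n :=
  dpPoly_eq_dpSum _

variable [CharZero K]

theorem derivative_univPoly_eq_truncated (n : ℕ) : derivative (univPoly K (n + 1)) =
    truncatedUnivPoly K (n + 1) n := by
  rw [univPoly_eq_truncated, truncatedUnivPoly, derivative_dpSum_C, truncatedUnivPoly]

theorem incidenceMk_dpSum {j : ℕ} (h1 : N < j) (h2 : j ≤ N + 2) :
    incidenceMk K (N + 2) (truncatedUnivPoly K (N + 2) j)
      = 0 := by
  refine Ideal.Quotient.eq_zero_iff_mem.mpr ?_
  obtain rfl | rfl : j = N + 1 ∨ j = N + 2 := by omega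
  · rw [← derivative_univPoly_eq_truncated]
    exact Ideal.subset_span (by simp)
  · rw [← univPoly_eq_truncated]
    exact Ideal.subset_span (by simp)

theorem incidenceHom_eq_zero {p : (MvPolynomial (Fin (N + 2)) K)[X]}
    (hp : p ∈ incidenceIdeal K (N + 2)) : incidenceHom K N p = 0 := by
  have : incidenceIdeal K (N + 2) ≤ RingHom.ker (incidenceHom K N) := by
    rw [incidenceIdeal, Ideal.span_le, Set.insert_subset_iff, Set.singleton_subset_iff,
      SetLike.mem_coe, SetLike.mem_coe, RingHom.mem_ker, RingHom.mem_ker,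
      derivative_univPoly_eq_truncated, univPoly_eq_truncated]
    exact ⟨incidenceHom_dpSum (by omega) le_rfl, incidenceHom_dpSum (by omega) (by omega)⟩
  exact this hp

/-- The section of `incidenceHom` up to the incidence relations. -/
def incidenceSection (K : Type*) [Field K] (N : ℕ) :
    (MvPolynomial (Fin N) K)[X] →ₐ[K] IncidenceRing K (N + 2) :=
  (incidenceMk K (N + 2)).comp
    (mapAlgHom (MvPolynomial.rename (Fin.castLE (Nat.le_add_right N 2))))

omit [CharZero K] in
theorem incidenceSection_C (a : MvPolynomial (Fin N) K) : incidenceSection K N (C a) =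
    incidenceMk K (N + 2) (C (MvPolynomial.rename (Fin.castLE (Nat.le_add_right N 2)) a)) := by
  simp [incidenceSection]

omit [CharZero K] in
theorem incidenceSection_X : incidenceSection K N X = incidenceMk K (N + 2) X := by
  simp [incidenceSection]

/-- The incidence relations `F = ∂F/∂x = 0` are the recursion for the indices `N+2` and `N+1`, so
the classes of the `s_j` satisfy it. -/
theorem incidenceSection_coeffSeq (i : Fin (N + 2)) :
    incidenceSection K N (coeffSeq K N (i + 1)) = incidenceMk K (N + 2) (C (MvPolynomial.X i)) := by
  refine map_coeffSeq_eq (incidenceSection K N)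
    (fun i => incidenceMk K (N + 2) (C (MvPolynomial.X i))) (fun i h => ?_) (fun j h1 h2 => ?_) i
  · rw [incidenceSection_C, MvPolynomial.rename_X]
    rfl
  · rw [← incidenceMk_dpSum h1 h2, truncatedUnivPoly, map_dpSum, incidenceSection_X]
    refine dpSum_congr _ _ fun b _ => ?_
    exact (map_extendSeq ((incidenceMk K (N + 2)).toRingHom.comp C) _ b).symm

variable (K N) in
/-- The incidence variety is an affine space with coordinates `s₁, …, s_N, x`. -/
def incidenceEquiv : IncidenceRing K (N + 2) ≃ₐ[K] (MvPolynomial (Fin N) K)[X] :=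
  AlgEquiv.ofAlgHom
    (Ideal.Quotient.liftₐ _ (incidenceHom K N) fun _ hp => incidenceHom_eq_zero hp)
    (incidenceSection K N)
    (by
      refine Polynomial.algHom_ext' (MvPolynomial.algHom_ext fun i => ?_) ?_
      · change incidenceHom K N (mapAlgHom (MvPolynomial.rename (Fin.castLE _))
          (C (MvPolynomial.X i))) = C (MvPolynomial.X i)
        rw [coe_mapAlgHom, map_C, incidenceHom_C]
        exact coeffHom_rename _ _
      · change incidenceHom K N (mapAlgHom (MvPolynomial.rename (Fin.castLE _)) X) = X
        simp [incidenceHom_X])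
    (by
      ext g
      obtain ⟨p, rfl⟩ := incidenceMk_surjective g
      change incidenceSection K N (incidenceHom K N p) = incidenceMk K (N + 2) p
      have : (incidenceSection K N).comp (incidenceHom K N) = incidenceMk K (N + 2) := by
        ext i
        · simp [incidenceHom_C, coeffHom, incidenceSection_coeffSeq]
        · simp [incidenceHom_X, incidenceSection_X]
      exact DFunLike.congr_fun this p)

theorem incidenceEquiv_mk (p : (MvPolynomial (Fin (N + 2)) K)[X]) :
    incidenceEquiv K N (incidenceMk K (N + 2) p) = incidenceHom K N p := rfl

theorem normalizationPullback_mk (n : ℕ) (p : MvPolynomial (Fin n) K) :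
    normalizationPullback K n (causticMk K n 2 p) = incidenceMk K n (C p) := rfl

theorem algebraMap_incidence (n : ℕ) (g : CausticRing K n 2) :
    algebraMap (CausticRing K n 2) (IncidenceRing K n) g = normalizationPullback K n g := rfl

theorem incidenceEquiv_normalizationPullback (g : CausticRing K (N + 2) 2) :
    incidenceEquiv K N (normalizationPullback K (N + 2) g) = causticEmbedding rfl g := by
  obtain ⟨p, rfl⟩ := causticMk_surjective g
  rw [normalizationPullback_mk, incidenceEquiv_mk, incidenceHom_C, causticEmbedding_mk]

theorem causticEmbedding_mem_swallowtail {m k : ℕ} (hm : m = N + k) (g : CausticRing K m k) :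
    causticEmbedding hm g ∈ swallowtail K N := by
  apply coeffSubalgebra_le_swallowtail m
  rw [← SetLike.mem_coe, ← range_causticEmbedding hm]
  exact ⟨g, rfl⟩

end Incidence

/-! ### Relative differentials and the kernel of `d`. -/

section Kaehler

variable {K : Type*} [Field K] [CharZero K] {N : ℕ}

local notation "𝓡" => CausticRing K (N + 2) 2
local notation "𝓑" => IncidenceRing K (N + 2)

/-- The free coefficients come from the discriminant, so the incidence ring is generated by `x` over
it; the chain rule then gives `dg = g' dx`. -/
theorem aeval_map_incidence (p : (MvPolynomial (Fin N) K)[X]) :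
    aeval (R := 𝓡) ((incidenceEquiv K N).symm X)
      (p.map ((causticMk K (N + 2) 2).comp
        (MvPolynomial.rename (Fin.castLE (Nat.le_add_right N 2)))).toRingHom) =
      (incidenceEquiv K N).symm p := by
  rw [aeval_def, eval₂_map]
  induction p using Polynomial.induction_on' with
  | add p q hp hq => rw [eval₂_add, hp, hq, map_add]
  | monomial k a =>
    rw [eval₂_monomial, ← C_mul_X_pow_eq_monomial, map_mul, map_pow]
    congr 1
    exact (incidenceSection_C a).symm

theorem D_incidenceEquiv_symm (p : (MvPolynomial (Fin N) K)[X]) :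
    KaehlerDifferential.D 𝓡 𝓑 ((incidenceEquiv K N).symm p) =
      (incidenceEquiv K N).symm (derivative p) •
        KaehlerDifferential.D 𝓡 𝓑 ((incidenceEquiv K N).symm X) := by
  rw [← aeval_map_incidence, Derivation.map_aeval, derivative_map, aeval_map_incidence]

/-- The coefficient `s_{N+1}` comes from the base, so its differential is zero, while its
`x`-derivative is `-w`. -/
theorem criticalPoly_smul_D_X :
    (incidenceEquiv K N).symm (criticalPoly K N) •
      KaehlerDifferential.D 𝓡 𝓑 ((incidenceEquiv K N).symm X) = 0 := by
  have h1 : coeffSeq K N (N + 1) ∈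
      Set.range (causticEmbedding (K := K) (m := N + 2) (k := 2) rfl) := by
    rw [range_causticEmbedding]
    exact coeffSeq_mem_coeffSubalgebra (by omega)
  obtain ⟨r, hr⟩ := h1
  have h2 := D_incidenceEquiv_symm (coeffSeq K N (N + 1))
  have h3 := derivative_coeffSeq K N 0
  rw [dpow_zero, mul_one, Nat.add_zero] at h3
  rw [h3, ← hr, ← incidenceEquiv_normalizationPullback, AlgEquiv.symm_apply_apply,
    ← algebraMap_incidence, Derivation.map_algebraMap, map_neg, neg_smul] at h2
  exact (neg_eq_zero.mp h2.symm)

theorem incidenceEquiv_symm_derivative_mul (a b : 𝓑) :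
    (incidenceEquiv K N).symm (derivative (incidenceEquiv K N (a * b))) =
      a * (incidenceEquiv K N).symm (derivative (incidenceEquiv K N b)) +
        b * (incidenceEquiv K N).symm (derivative (incidenceEquiv K N a)) := by
  rw [map_mul, derivative_mul, map_add, map_mul, map_mul, AlgEquiv.symm_apply_apply,
    AlgEquiv.symm_apply_apply, mul_comm]
  exact add_comm _ _

theorem dvd_incidenceEquiv_symm_derivative_algebraMap (r : 𝓡) :
    (incidenceEquiv K N).symm (criticalPoly K N) ∣
      (incidenceEquiv K N).symm (derivative (incidenceEquiv K N (algebraMap 𝓡 𝓑 r))) := by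
  rw [algebraMap_incidence, incidenceEquiv_normalizationPullback]
  exact map_dvd _ (causticEmbedding_mem_swallowtail rfl r)

variable (K N) in
/-- The ideal of the critical locus of the normalization map. -/
def criticalIdeal : Ideal 𝓑 := Ideal.span {(incidenceEquiv K N).symm (criticalPoly K N)}

variable (K N) in
/-- The linear map `∂/∂x` with values modulo `criticalPoly`. -/
def swallowtailLinearMap : 𝓑 →ₗ[𝓡] 𝓑 ⧸ criticalIdeal K N where
  toFun g := Ideal.Quotient.mk _ ((incidenceEquiv K N).symm (derivative (incidenceEquiv K N g)))
  map_add' a b := by simp only [map_add]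
  map_smul' r g := by
    have h : Ideal.Quotient.mk (criticalIdeal K N) ((incidenceEquiv K N).symm
        (derivative (incidenceEquiv K N (algebraMap 𝓡 𝓑 r)))) = 0 :=
      Ideal.Quotient.eq_zero_iff_mem.mpr (Ideal.mem_span_singleton.mpr
        (dvd_incidenceEquiv_symm_derivative_algebraMap r))
    rw [RingHom.id_apply, Algebra.smul_def, Algebra.smul_def,
      IsScalarTower.algebraMap_apply 𝓡 𝓑 (𝓑 ⧸ criticalIdeal K N),
      Ideal.Quotient.algebraMap_eq, incidenceEquiv_symm_derivative_mul, map_add, map_mul,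
      map_mul, h, mul_zero, add_zero]

theorem swallowtailLinearMap_apply (g : 𝓑) : swallowtailLinearMap K N g =
    Ideal.Quotient.mk _ ((incidenceEquiv K N).symm (derivative (incidenceEquiv K N g))) := rfl

variable (K N) in
/-- The derivation `∂/∂x` with values modulo `criticalPoly`. -/
def swallowtailDerivation : Derivation 𝓡 𝓑 (𝓑 ⧸ criticalIdeal K N) :=
  Derivation.mk' (swallowtailLinearMap K N) fun a b => by
    rw [swallowtailLinearMap_apply, swallowtailLinearMap_apply, swallowtailLinearMap_apply,
      incidenceEquiv_symm_derivative_mul, map_add, map_mul, map_mul, Algebra.smul_def,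
      Algebra.smul_def, Ideal.Quotient.algebraMap_eq]

/-- Forward, the derivation `∂/∂x` modulo `w` factors through `d`; backward, `dg = g' dx` and `w dx
= 0`. -/
theorem D_eq_zero_iff (g : 𝓑) :
    KaehlerDifferential.D 𝓡 𝓑 g = 0 ↔ incidenceEquiv K N g ∈ swallowtail K N := by
  constructor
  · intro h
    have h1 := (swallowtailDerivation K N).liftKaehlerDifferential_comp_D g
    rw [h, map_zero] at h1
    have h2 := Ideal.mem_span_singleton.mp (Ideal.Quotient.eq_zero_iff_mem.mp h1.symm)
    have h3 := map_dvd (incidenceEquiv K N) h2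
    rwa [AlgEquiv.apply_symm_apply, AlgEquiv.apply_symm_apply] at h3
  · rintro ⟨h, hh⟩
    rw [← (incidenceEquiv K N).symm_apply_apply g, D_incidenceEquiv_symm, hh, mul_comm, map_mul,
      mul_smul, criticalPoly_smul_D_X, smul_zero]

end Kaehler

end OpenSwallowtail

end

/-! ### The theorem. -/

open OpenSwallowtail
theorem mainTheorem5 (K : Type*) [Field K] [IsAlgClosed K] [CharZero K] (n : ℕ) (hn : 3 ≤ n) :
    (∀ i : ℕ, Function.Bijective (diffPullback K (n + i) (2 + i) 1) ↔ n - 3 ≤ i) ∧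
    ∃ φ : CausticRing K (n + (n - 3)) (2 + (n - 3)) →ₐ[K] IncidenceRing K n,
      φ.comp (diffPullback K n 2 (n - 3)) = normalizationPullback K n ∧
      (∀ ψ : CausticRing K (n + (n - 3)) (2 + (n - 3)) →ₐ[K] IncidenceRing K n,
        ψ.comp (diffPullback K n 2 (n - 3)) = normalizationPullback K n → ψ = φ) ∧
      Function.Injective φ ∧
      Set.range φ = (algebraicOpenSwallowtail K n : Set (IncidenceRing K n)) := by
  obtain ⟨N, rfl⟩ : ∃ N, n = N + 2 := ⟨n - 2, by omega⟩
  have hm (i : ℕ) : N + 2 + i = N + (2 + i) := by omega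
  refine ⟨fun i => ?_, ((incidenceEquiv K N).symm : _ →ₐ[K] _).comp (causticEmbedding (hm _)),
    ?_, fun ψ hψ => ?_, ?_, ?_⟩
  -- Here `m = N + 2 + i`, and `2N + 1 ≤ m` means `i ≥ N - 1 = n - 3`.
  · rw [diffPullback_bijective_iff (hm i)]
    omega
  · ext1 g
    change (incidenceEquiv K N).symm (causticEmbedding (hm _) (diffPullback K (N + 2) 2 _ g)) = _
    rw [causticEmbedding_diffPullback rfl (hm _), ← incidenceEquiv_normalizationPullback,
      AlgEquiv.symm_apply_apply]
  · have h := eq_causticEmbedding rfl (hm _) ((incidenceEquiv K N : _ →ₐ[K] _).comp ψ) fun g => by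
      rw [← incidenceEquiv_normalizationPullback, ← hψ]
      rfl
    rw [← h]
    ext1 g
    exact ((incidenceEquiv K N).symm_apply_apply (ψ g)).symm
  · exact (incidenceEquiv K N).symm.injective.comp (causticEmbedding_injective (hm _))
  · ext g
    have h1 : g ∈ (algebraicOpenSwallowtail K (N + 2) : Set (IncidenceRing K (N + 2))) ↔
        incidenceEquiv K N g ∈ swallowtail K N := D_eq_zero_iff g
    -- Since `n ≥ 3`, the index `2n - 3` equals `2N + 1`, the first stable one.
    rw [h1, ← coeffSubalgebra_eq_swallowtail (m := N + 2 + (N + 2 - 3)) (by omega),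
      ← SetLike.mem_coe, ← range_causticEmbedding (hm _)]
    constructor
    · rintro ⟨r, rfl⟩
      exact ⟨r, ((incidenceEquiv K N).apply_symm_apply _).symm⟩
    · rintro ⟨r, hr⟩
      exact ⟨r, (incidenceEquiv K N).symm_apply_eq.mpr hr⟩
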